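/- Let $(X,d)$ be a Hadamard space, that is, a complete geodesic metric space in which, for every geodesic triangle, distances between points on its sides are no larger than the distances between the corresponding points of a comparison triangle in the Euclidean plane. Let $A\subset X$ be a nonempty finite set and let $\bar x\in X$. Say that $\bar x$ is \emph{$A$-minimal} if there is no point $x\in X$ with $d(a,x)<d(a,\bar x)$ for all $a\in A$. Say that $\bar x$ is \emph{$A$-balanced} if either $\bar x\in A$, or $\bar x\notin A$ and for every point $y\ne\bar x$ in $X$ there is a point $a\in A$ such that the Alexandrov angle $\angle y\bar x a$ at $\bar x$ between the geodesics from $\bar x$ to $y$ and from $\bar x$ to $a$ is at least $\frac{\pi}{2}$. Finally, let the \emph{mean set} of $A$ be the set of all barycenters, that is, of all points that minimize $x\mapsto\sum_{a\in A}w_a\,d(a,x)^2$ over $X$ for some weights $w_a\ge 0$ $(a\in A)$ with $\sum_{a\in A}w_a=1$. Then $\bar x$ is $A$-minimal if and only if it is $A$-balanced. Moreover, $\bar x$ is $A$-minimal if and only if it belongs to the mean set of $A$. -/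

import Mathlib

open Filter Topology

/-- `γ`, restricted to `[0, d(x,y)]`, is an isometric embedding that starts at `x` and ends at `y`;
its values outside `[0, d(x,y)]` are irrelevant. -/
structure IsGeodesic {X : Type*} [MetricSpace X] (γ : ℝ → X) (x y : X) : Prop where
  source : γ 0 = x
  target : γ (dist x y) = y
  isometry : ∀ s ∈ Set.Icc (0 : ℝ) (dist x y), ∀ t ∈ Set.Icc (0 : ℝ) (dist x y),
    dist (γ s) (γ t) = |s - t|

/-- A geodesic triangle: three points, and for each `i` (modulo `3`) a geodesic segment from
the `i`-th to the `(i+1)`-st of them. -/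
structure GeodesicTriangle (X : Type*) [MetricSpace X] where
  vertex : Fin 3 → X
  side : Fin 3 → ℝ → X
  isGeodesic : ∀ i, IsGeodesic (side i) (vertex i) (vertex (i + 1))

namespace GeodesicTriangle

variable {X : Type*} [MetricSpace X]

/-- The length of the `i`-th side. -/
noncomputable def sideLength (T : GeodesicTriangle X) (i : Fin 3) : ℝ :=
  dist (T.vertex i) (T.vertex (i + 1))

/-- The points `v 0, v 1, v 2` of the Euclidean plane are the vertices of a comparison triangle. -/
def IsComparison (T : GeodesicTriangle X) (v : Fin 3 → EuclideanSpace ℝ (Fin 2)) : Prop :=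
  ∀ i, dist (v i) (v (i + 1)) = T.sideLength i

/-- Distances between points on the sides of `T` are no larger than the distances between the
corresponding points of a comparison triangle. Here the point of the `i`-th Euclidean side
corresponding to `T.side i s` is the point of the segment `[v i, v (i+1)]` at distance `s`
from `v i`. -/
def SatisfiesCAT0 (T : GeodesicTriangle X) : Prop :=
  ∀ v : Fin 3 → EuclideanSpace ℝ (Fin 2), T.IsComparison v →
    ∀ i j : Fin 3, ∀ s ∈ Set.Icc 0 (T.sideLength i), ∀ t ∈ Set.Icc 0 (T.sideLength j),
      ∀ p ∈ segment ℝ (v i) (v (i + 1)), ∀ q ∈ segment ℝ (v j) (v (j + 1)),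
        dist (v i) p = s → dist (v j) q = t →
          dist (T.side i s) (T.side j t) ≤ dist p q

end GeodesicTriangle

/-- A Hadamard space: a complete geodesic metric space that is CAT(0). -/
class HadamardSpace (X : Type*) [MetricSpace X] : Prop where
  complete : CompleteSpace X
  exists_isGeodesic : ∀ x y : X, ∃ γ : ℝ → X, IsGeodesic γ x y
  cat0 : ∀ T : GeodesicTriangle X, T.SatisfiesCAT0

/-- The comparison angle at `p` between `x` and `y`: the angle at the vertex corresponding to `p`
of a Euclidean triangle with side lengths `d(p,x)`, `d(p,y)`, `d(x,y)` (law of cosines).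
It is used only for `x ≠ p` and `y ≠ p`. -/
noncomputable def comparisonAngle {X : Type*} [MetricSpace X] (p x y : X) : ℝ :=
  Real.arccos ((dist p x ^ 2 + dist p y ^ 2 - dist x y ^ 2) / (2 * dist p x * dist p y))

/-- The Alexandrov angle between two geodesics with the same origin `γ 0 = η 0`: the upper limit
of the comparison angles at the origin between `γ s` and `η t`, as `s, t → 0` through positive
values. -/
noncomputable def alexandrovAngle {X : Type*} [MetricSpace X] (γ η : ℝ → X) : ℝ :=
  limsup (fun r : ℝ × ℝ => comparisonAngle (γ 0) (γ r.1) (η r.2))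
    (𝓝[>] (0 : ℝ) ×ˢ 𝓝[>] (0 : ℝ))

namespace HadamardSpace

variable {X : Type*} [MetricSpace X] [HadamardSpace X]

/-- The geodesic from `x` to `y`, unique on `[0, d(x,y)]` by `eqOn_geodesic`. -/
noncomputable def geodesic (x y : X) : ℝ → X :=
  Classical.choose (exists_isGeodesic x y)

theorem isGeodesic_geodesic (x y : X) : IsGeodesic (geodesic x y) x y :=
  Classical.choose_spec (exists_isGeodesic x y)

/-- Geodesics in a Hadamard space are unique. -/
theorem eqOn_geodesic {γ : ℝ → X} {x y : X} (hγ : IsGeodesic γ x y) :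
    Set.EqOn γ (geodesic x y) (Set.Icc 0 (dist x y)) := by
  intro s hs
  have hη := isGeodesic_geodesic x y
  set η := geodesic x y
  have hrev : IsGeodesic (fun t => η (dist x y - t)) y x := by
    refine ⟨by simpa using hη.target, by simpa [dist_comm y x] using hη.source, ?_⟩
    intro a ha b hb
    rw [dist_comm y x] at ha hb
    rw [hη.isometry _ ⟨by linarith [ha.2], by linarith [ha.1]⟩ _
      ⟨by linarith [hb.2], by linarith [hb.1]⟩, abs_sub_comm]
    congr 1
    ring
  have hconst : IsGeodesic (fun _ : ℝ => y) y y := by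
    refine ⟨rfl, rfl, ?_⟩
    intro a ha b hb
    rw [dist_self] at ha hb
    have h1 : a = 0 := le_antisymm ha.2 ha.1
    have h2 : b = 0 := le_antisymm hb.2 hb.1
    simp [h1, h2]
  let T : GeodesicTriangle X :=
    { vertex := ![x, y, y]
      side := ![γ, fun _ => y, fun t => η (dist x y - t)]
      isGeodesic := by
        intro i
        fin_cases i
        · exact hγ
        · exact hconst
        · exact hrev }
  let P : ℝ → EuclideanSpace ℝ (Fin 2) := fun a => EuclideanSpace.single 0 a
  have hP : ∀ a b : ℝ, dist (P a) (P b) = |a - b| := by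
    intro a b
    simp [P, Real.dist_eq]
  have hd : 0 ≤ dist x y := dist_nonneg
  have hcomp : T.IsComparison ![P 0, P (dist x y), P (dist x y)] := by
    intro i
    fin_cases i
    · change dist (P 0) (P (dist x y)) = dist x y
      rw [hP, zero_sub, abs_neg, abs_of_nonneg hd]
    · change dist (P _) (P _) = dist y y
      simp
    · change dist (P (dist x y)) (P 0) = dist y x
      rw [hP, sub_zero, abs_of_nonneg hd, dist_comm]
  have hseg : P s ∈ segment ℝ (P 0) (P (dist x y)) := by
    rw [mem_segment_iff_wbtw, ← dist_add_dist_eq_iff, hP, hP, hP, zero_sub, zero_sub, abs_neg,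
      abs_neg, abs_of_nonneg hs.1, abs_of_nonneg hd, abs_sub_comm,
      abs_of_nonneg (sub_nonneg.2 hs.2)]
    ring
  have key := cat0 T _ hcomp 0 2 s hs (dist x y - s)
    ⟨sub_nonneg.2 hs.2, by change _ ≤ dist y x; rw [dist_comm y x]; linarith [hs.1]⟩
    (P s) hseg (P s) (by rw [segment_symm]; exact hseg)
    (by change dist (P 0) (P s) = s
        rw [hP, zero_sub, abs_neg, abs_of_nonneg hs.1])
    (by change dist (P (dist x y)) (P s) = dist x y - s
        rw [hP, abs_of_nonneg (sub_nonneg.2 hs.2)])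
  have key' : dist (γ s) (η (dist x y - (dist x y - s))) ≤ dist (P s) (P s) := key
  rw [dist_self, sub_sub_cancel] at key'
  exact dist_le_zero.1 key'

/-- The Alexandrov angle `∠ y p a` at `p` between the geodesics from `p` to `y` and to `a`. -/
noncomputable def angle (y p a : X) : ℝ :=
  alexandrovAngle (geodesic p y) (geodesic p a)

end HadamardSpace

/-- The set of `A`-minimal points: no point is strictly closer than `x` to every point of `A`. -/
def minimalSet {X : Type*} [MetricSpace X] (A : Finset X) : Set X :=
  {x | ¬ ∃ z : X, ∀ a ∈ A, dist a z < dist a x}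

/-- The mean set: the points that minimize, for some weight vector `w` in the simplex over `A`,
the weighted sum of the squared distances to the points of `A`. -/
def meanSet {X : Type*} [MetricSpace X] (A : Finset X) : Set X :=
  {x | ∃ w ∈ stdSimplex ℝ A, ∀ z : X,
    ∑ a : A, w a * dist (a : X) x ^ 2 ≤ ∑ a : A, w a * dist (a : X) z ^ 2}

/-- `x` is `A`-balanced. -/
def IsBalanced {X : Type*} [MetricSpace X] [HadamardSpace X] (A : Finset X) (x : X) : Prop :=
  x ∈ A ∨ (x ∉ A ∧ ∀ y : X, y ≠ x → ∃ a ∈ A, Real.pi / 2 ≤ HadamardSpace.angle y x a)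

/-! Both equivalences rest on one CAT(0) inequality, `dist_sq_le_of_isGeodesic`. It makes comparison
angles shrink towards the vertex, so the Alexandrov angle is at most the comparison angle. A point
`z` closer to `a` than `x` is therefore seen from `x` at an acute angle to `a`; conversely, an acute
angle to every `a` lets a short move along one geodesic approach all of the finite set `A` at once.
This is minimal versus balanced. The same inequality makes squared distances convex along geodesics,
so the vectors dominating a squared-distance vector form a convex set. Minimality of `x` makes it
disjoint from an open orthant, and a separating functional supplies the weights. -/

/-- Three lengths satisfying the triangle inequalities are the side lengths of a triangle in the
Euclidean plane with one vertex at the origin. -/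
theorem exists_euclidean_triangle {b c e : ℝ} (hb : 0 ≤ b) (hc : 0 ≤ c)
    (h₁ : e ≤ b + c) (h₂ : b ≤ e + c) (h₃ : c ≤ e + b) :
    ∃ p q : EuclideanSpace ℝ (Fin 2), ‖p‖ = b ∧ ‖q‖ = c ∧ dist p q = e := by
  have he : 0 ≤ e := by linarith
  rcases hb.eq_or_lt with rfl | hb'
  · refine ⟨0, EuclideanSpace.single 0 c, by simp, by simp [abs_of_nonneg hc], ?_⟩
    have hce : c = e := by linarith
    simp [abs_of_nonneg he, hce]
  -- With `p = (b, 0)`, the law of cosines forces `u` as first coordinate of `q`; the triangle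
  -- inequalities give `|u| ≤ c`.
  · set u := (b ^ 2 + c ^ 2 - e ^ 2) / (2 * b) with hu
    have hub : 2 * b * u = b ^ 2 + c ^ 2 - e ^ 2 := by rw [hu]; field_simp
    have hle : u ^ 2 ≤ c ^ 2 := by
      apply sq_le_sq'
      · have : 0 ≤ 2 * b * (u + c) := by
          have : 2 * b * (u + c) = (b + c - e) * (b + c + e) := by linear_combination hub
          rw [this]
          exact mul_nonneg (by linarith) (by linarith)
        linarith [nonneg_of_mul_nonneg_right this (by positivity)]
      · have : 0 ≤ 2 * b * (c - u) := by
          have : 2 * b * (c - u) = (e - b + c) * (e + b - c) := by linear_combination -hub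
          rw [this]
          exact mul_nonneg (by linarith) (by linarith)
        linarith [nonneg_of_mul_nonneg_right this (by positivity)]
    have hs := Real.sq_sqrt (sub_nonneg.2 hle)
    refine ⟨!₂[b, 0], !₂[u, √(c ^ 2 - u ^ 2)], ?_, ?_, ?_⟩
    · simp [EuclideanSpace.norm_eq, Real.sqrt_sq hb]
    · simp [EuclideanSpace.norm_eq, hs, Real.sqrt_sq hc]
    · rw [EuclideanSpace.dist_eq, Real.sqrt_eq_iff_eq_sq (by positivity) he]
      simp only [Fin.sum_univ_two, Real.dist_eq, sq_abs]
      simp only [Matrix.cons_val_zero, Matrix.cons_val_one]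
      linear_combination hs - hub

/-- The law of cosines for the multiples `s • p` and `t • q`, in terms of the side lengths of the
triangle `0`, `p`, `q`. -/
theorem dist_smul_smul_sq {E : Type*} [NormedAddCommGroup E] [InnerProductSpace ℝ E]
    (p q : E) (s t : ℝ) :
    dist (s • p) (t • q) ^ 2 =
      s ^ 2 * ‖p‖ ^ 2 + t ^ 2 * ‖q‖ ^ 2 - s * t * (‖p‖ ^ 2 + ‖q‖ ^ 2 - dist p q ^ 2) := by
  rw [dist_eq_norm, dist_eq_norm, norm_sub_sq_real, norm_sub_sq_real, norm_smul, norm_smul,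
    inner_smul_left, inner_smul_right, mul_pow, mul_pow, Real.norm_eq_abs, Real.norm_eq_abs,
    sq_abs, sq_abs, RCLike.conj_to_real]
  ring

namespace IsGeodesic

variable {X : Type*} [MetricSpace X] {γ : ℝ → X} {x y : X}

theorem dist_source (h : IsGeodesic γ x y) {s : ℝ} (hs : s ∈ Set.Icc 0 (dist x y)) :
    dist x (γ s) = s := by
  have := h.isometry 0 ⟨le_rfl, dist_nonneg⟩ s hs
  rwa [h.source, zero_sub, abs_neg, abs_of_nonneg hs.1] at this

theorem dist_target (h : IsGeodesic γ x y) {s : ℝ} (hs : s ∈ Set.Icc 0 (dist x y)) :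
    dist y (γ s) = dist x y - s := by
  have := h.isometry (dist x y) ⟨dist_nonneg, le_rfl⟩ s hs
  rwa [h.target, abs_of_nonneg (sub_nonneg.2 hs.2)] at this

theorem reverse (h : IsGeodesic γ x y) : IsGeodesic (fun t => γ (dist x y - t)) y x := by
  refine ⟨by simpa using h.target, by simpa [dist_comm y x] using h.source, ?_⟩
  intro a ha b hb
  rw [dist_comm y x] at ha hb
  rw [h.isometry _ ⟨by linarith [ha.2], by linarith [ha.1]⟩ _
    ⟨by linarith [hb.2], by linarith [hb.1]⟩, abs_sub_comm]
  congr 1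
  ring

end IsGeodesic

theorem comparisonAngle_nonneg {X : Type*} [MetricSpace X] (p x y : X) :
    0 ≤ comparisonAngle p x y := Real.arccos_nonneg _

theorem comparisonAngle_le_pi {X : Type*} [MetricSpace X] (p x y : X) :
    comparisonAngle p x y ≤ Real.pi := Real.arccos_le_pi _

namespace HadamardSpace

variable {X : Type*} [MetricSpace X] [HadamardSpace X]

/-- The CAT(0) inequality for two points on two sides with a common vertex. -/
theorem dist_sq_le_of_isGeodesic {γ η : ℝ → X} {x y z : X} (hγ : IsGeodesic γ x y)
    (hη : IsGeodesic η x z) {s t : ℝ} (hs : s ∈ Set.Icc (0 : ℝ) 1) (ht : t ∈ Set.Icc (0 : ℝ) 1) :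
    dist (γ (s * dist x y)) (η (t * dist x z)) ^ 2 ≤
      s ^ 2 * dist x y ^ 2 + t ^ 2 * dist x z ^ 2
        - s * t * (dist x y ^ 2 + dist x z ^ 2 - dist y z ^ 2) := by
  obtain ⟨p, q, hp, hq, hpq⟩ := exists_euclidean_triangle (b := dist x y) (c := dist x z)
    (e := dist y z) dist_nonneg dist_nonneg (by linarith [dist_triangle_left y z x])
    (by linarith [dist_triangle_right x y z])
    (by linarith [dist_triangle x y z])
  let T : GeodesicTriangle X :=
    { vertex := ![x, y, z]
      side := ![γ, geodesic y z, fun r => η (dist x z - r)]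
      isGeodesic := by
        intro i
        fin_cases i
        · exact hγ
        · exact isGeodesic_geodesic y z
        · exact hη.reverse }
  have hcomp : T.IsComparison ![0, p, q] := by
    intro i
    fin_cases i
    · change dist 0 p = dist x y
      rw [dist_zero_left, hp]
    · exact hpq
    · change dist q 0 = dist z x
      rw [dist_zero_right, hq, dist_comm]
  have hxy : 0 ≤ dist x y := dist_nonneg
  have hxz : 0 ≤ dist x z := dist_nonneg
  -- The third side runs from `z` back to `x`, hence the parameter `1 - t`.
  have key := cat0 T _ hcomp 0 2 (s * dist x y)
    ⟨mul_nonneg hs.1 hxy, mul_le_of_le_one_left hxy hs.2⟩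
    ((1 - t) * dist x z)
    ⟨mul_nonneg (sub_nonneg.2 ht.2) hxz, by
      change _ ≤ dist z x
      rw [dist_comm z x]
      exact mul_le_of_le_one_left hxz (by linarith [ht.1])⟩
    (s • p) ⟨1 - s, s, sub_nonneg.2 hs.2, hs.1, by ring, by
      change (1 - s) • 0 + s • p = s • p
      simp⟩
    (t • q) ⟨t, 1 - t, ht.1, sub_nonneg.2 ht.2, by ring, by
      change t • q + (1 - t) • 0 = t • q
      simp⟩
    (by
      change dist 0 (s • p) = _
      rw [dist_zero_left, norm_smul, Real.norm_of_nonneg hs.1, hp])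
    (by
      change dist q (t • q) = _
      have : q - t • q = (1 - t) • q := by module
      rw [dist_eq_norm, this, norm_smul, Real.norm_of_nonneg (sub_nonneg.2 ht.2), hq])
  have key' : dist (γ (s * dist x y)) (η (dist x z - (1 - t) * dist x z)) ≤
    dist (s • p) (t • q) := key
  rw [show dist x z - (1 - t) * dist x z = t * dist x z by ring] at key'
  rw [← hpq, ← hp, ← hq, ← dist_smul_smul_sq, hp, hq]
  gcongr

/-- The squared distance to a point is convex along geodesics. -/
theorem dist_sq_le_of_mem_geodesic (a : X) {γ : ℝ → X} {x y : X} (hγ : IsGeodesic γ x y) {s : ℝ}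
    (hs : s ∈ Set.Icc (0 : ℝ) 1) :
    dist a (γ (s * dist x y)) ^ 2 ≤ (1 - s) * dist a x ^ 2 + s * dist a y ^ 2 := by
  have hη := isGeodesic_geodesic x a
  have h := dist_sq_le_of_isGeodesic hγ hη hs (t := 1) ⟨zero_le_one, le_rfl⟩
  rw [one_mul, hη.target, dist_comm _ a, dist_comm x a, dist_comm y a] at h
  -- The strong convexity term, not needed here.
  have : 0 ≤ s * (1 - s) * dist x y ^ 2 :=
    mul_nonneg (mul_nonneg hs.1 (sub_nonneg.2 hs.2)) (sq_nonneg _)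
  linarith

/-- Comparison angles decrease towards the common vertex of two geodesics. -/
theorem comparisonAngle_geodesic_le {x y z : X} {s t : ℝ}
    (hs : s ∈ Set.Ioc 0 (dist x y)) (ht : t ∈ Set.Ioc 0 (dist x z)) :
    comparisonAngle x (geodesic x y s) (geodesic x z t) ≤ comparisonAngle x y z := by
  have hγ := isGeodesic_geodesic x y
  have hη := isGeodesic_geodesic x z
  have hxy : 0 < dist x y := hs.1.trans_le hs.2
  have hxz : 0 < dist x z := ht.1.trans_le ht.2
  have h := dist_sq_le_of_isGeodesic hγ hη (s := s / dist x y) (t := t / dist x z)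
    ⟨div_nonneg hs.1.le hxy.le, div_le_one_of_le₀ hs.2 hxy.le⟩
    ⟨div_nonneg ht.1.le hxz.le, div_le_one_of_le₀ ht.2 hxz.le⟩
  rw [div_mul_cancel₀ _ hxy.ne', div_mul_cancel₀ _ hxz.ne', ← mul_pow, ← mul_pow,
    div_mul_cancel₀ _ hxy.ne', div_mul_cancel₀ _ hxz.ne'] at h
  refine Real.arccos_le_arccos ?_
  rw [hγ.dist_source ⟨hs.1.le, hs.2⟩, hη.dist_source ⟨ht.1.le, ht.2⟩]
  rw [le_div_iff₀ (mul_pos (mul_pos two_pos hs.1) ht.1)]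
  calc _ = s / dist x y * (t / dist x z) * (dist x y ^ 2 + dist x z ^ 2 - dist y z ^ 2) := by
        field_simp
    _ ≤ _ := by linarith

theorem angle_le_comparisonAngle {x y z : X} (hy : y ≠ x) (hz : z ≠ x) :
    angle y x z ≤ comparisonAngle x y z := by
  refine limsup_le_of_le ⟨0, fun b hb => ?_⟩ ?_
  · obtain ⟨r, hr⟩ := (Filter.eventually_map.1 hb).exists
    exact (comparisonAngle_nonneg _ _ _).trans hr
  · have h₁ : Set.Ioc 0 (dist x y) ∈ 𝓝[>] (0 : ℝ) := Ioc_mem_nhdsGT (dist_pos.2 hy.symm)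
    have h₂ : Set.Ioc 0 (dist x z) ∈ 𝓝[>] (0 : ℝ) := Ioc_mem_nhdsGT (dist_pos.2 hz.symm)
    filter_upwards [prod_mem_prod h₁ h₂] with r hr
    rw [(isGeodesic_geodesic x y).source]
    exact comparisonAngle_geodesic_le hr.1 hr.2

/-- In a Euclidean triangle, the angle opposite a side that is not the longest is acute. -/
theorem angle_lt_pi_div_two_of_dist_lt {x z a : X} (h : dist a z < dist a x) (ha : a ≠ x) :
    angle z x a < Real.pi / 2 := by
  have hz : z ≠ x := by
    rintro rfl
    exact lt_irrefl _ h
  refine (angle_le_comparisonAngle hz ha).trans_lt ?_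
  have hxz : 0 < dist x z := dist_pos.2 hz.symm
  have hxa : 0 < dist x a := dist_pos.2 ha.symm
  refine Real.arccos_lt_pi_div_two.2 (div_pos ?_ (by positivity))
  rw [dist_comm a z, dist_comm a x] at h
  have : dist z a ^ 2 < dist x a ^ 2 := by gcongr
  nlinarith

/-- If the angle at `x` between `y` and `a` is acute, then the geodesic from `x` to `y` initially
moves closer to `a`. -/
theorem eventually_dist_lt_of_angle_lt {x y a : X} (hy : y ≠ x) (ha : a ≠ x)
    (h : angle y x a < Real.pi / 2) :
    ∀ᶠ s in 𝓝[>] (0 : ℝ), dist a (geodesic x y s) < dist a x := by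
  have hγ := isGeodesic_geodesic x y
  have hη := isGeodesic_geodesic x a
  obtain ⟨θ, hθ, hθ'⟩ := exists_between h
  have hev := eventually_lt_of_limsup_lt hθ ⟨Real.pi, Filter.eventually_map.2
    (Filter.Eventually.of_forall fun _ => comparisonAngle_le_pi _ _ _)⟩
  rw [hγ.source] at hev
  obtain ⟨P, hP, Q, hQ, hPQ⟩ := Filter.eventually_prod_iff.1 hev
  have hQ' : ∀ᶠ t in 𝓝[>] (0 : ℝ), t ∈ Set.Ioc 0 (dist x a) :=
    Ioc_mem_nhdsGT (dist_pos.2 ha.symm)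
  obtain ⟨t, hQt, ht⟩ := (hQ.and hQ').exists
  -- A single sample pair of parameters shows `0 < θ`, as `arccos (cos θ) = θ` requires.
  obtain ⟨s₀, hPs₀, hs₀⟩ := (hP.and (Ioc_mem_nhdsGT (dist_pos.2 hy.symm))).exists
  have hθ₀ : 0 < θ := (comparisonAngle_nonneg _ _ _).trans_lt (hPQ hPs₀ hQt)
  have hc : 0 < Real.cos θ := Real.cos_pos_of_mem_Ioo ⟨by linarith, hθ'⟩
  -- With `t` fixed, `s ^ 2 + t ^ 2 - 2 * s * t * cos θ < t ^ 2` exactly when `s < 2 * t * cos θ`.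
  have hsmall : 0 < min (dist x y) (2 * Real.cos θ * t) :=
    lt_min (dist_pos.2 hy.symm) (mul_pos (mul_pos two_pos hc) ht.1)
  filter_upwards [hP, Ioo_mem_nhdsGT hsmall] with s hPs hs
  have hs₁ : s < dist x y := hs.2.trans_le (min_le_left _ _)
  have hs₂ : s < 2 * Real.cos θ * t := hs.2.trans_le (min_le_right _ _)
  have hangle : comparisonAngle x (geodesic x y s) (geodesic x a t) < θ := hPQ hPs hQt
  rw [comparisonAngle, hγ.dist_source ⟨hs.1.le, hs₁.le⟩, hη.dist_source ⟨ht.1.le, ht.2⟩] at hangle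
  have hcos : Real.cos θ < (s ^ 2 + t ^ 2 - dist (geodesic x y s) (geodesic x a t) ^ 2) /
      (2 * s * t) := by
    by_contra! hle
    have := Real.arccos_le_arccos hle
    rw [Real.arccos_cos hθ₀.le (by linarith [Real.pi_pos])] at this
    linarith
  rw [lt_div_iff₀ (mul_pos (mul_pos two_pos hs.1) ht.1)] at hcos
  have hlt : dist (geodesic x y s) (geodesic x a t) < t := by
    refine lt_of_pow_lt_pow_left₀ 2 ht.1.le ?_
    nlinarith [mul_lt_mul_of_pos_left hs₂ hs.1]
  calc dist a (geodesic x y s)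
      ≤ dist a (geodesic x a t) + dist (geodesic x a t) (geodesic x y s) := dist_triangle _ _ _
    _ = dist x a - t + dist (geodesic x y s) (geodesic x a t) := by
        rw [hη.dist_target ⟨ht.1.le, ht.2⟩, dist_comm (geodesic x a t)]
    _ < dist a x := by rw [dist_comm a x]; linarith

theorem isBalanced_of_mem_minimalSet {A : Finset X} {x : X} (hx : x ∈ minimalSet A) :
    IsBalanced A x := by
  by_cases hxA : x ∈ A
  · exact Or.inl hxA
  · refine Or.inr ⟨hxA, fun y hy => ?_⟩
    by_contra! hlt
    have hev : ∀ᶠ s in 𝓝[>] (0 : ℝ), ∀ a ∈ A, dist a (geodesic x y s) < dist a x :=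
      (Filter.eventually_all_finset A).2 fun a ha => eventually_dist_lt_of_angle_lt hy
        (ne_of_mem_of_not_mem ha hxA) (hlt a ha)
    obtain ⟨s, hs⟩ := hev.exists
    exact hx ⟨_, hs⟩

theorem mem_minimalSet_of_isBalanced {A : Finset X} (hA : A.Nonempty) {x : X}
    (hx : IsBalanced A x) : x ∈ minimalSet A := by
  rintro ⟨z, hz⟩
  rcases hx with hxA | ⟨hxA, hx⟩
  · have := hz x hxA
    rw [dist_self] at this
    exact absurd this (not_lt.2 dist_nonneg)
  · have hzx : z ≠ x := by
      rintro rfl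
      obtain ⟨a, ha⟩ := hA
      exact lt_irrefl _ (hz a ha)
    obtain ⟨a, ha, hangle⟩ := hx z hzx
    exact absurd hangle (not_le.2
      (angle_lt_pi_div_two_of_dist_lt (hz a ha) (ne_of_mem_of_not_mem ha hxA)))

/-- The vectors dominating some vector of squared distances to the points of `A` form a convex
set. -/
theorem convex_setOf_dist_sq_le (A : Finset X) :
    Convex ℝ {v : A → ℝ | ∃ z : X, ∀ a : A, dist (a : X) z ^ 2 ≤ v a} := by
  rintro u ⟨y, hy⟩ v ⟨z, hz⟩ r s hr hs hrs
  refine ⟨geodesic y z (s * dist y z), fun a => ?_⟩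
  refine (dist_sq_le_of_mem_geodesic (a : X) (isGeodesic_geodesic y z)
    ⟨hs, by linarith⟩).trans ?_
  rw [show 1 - s = r by linarith]
  exact add_le_add (mul_le_mul_of_nonneg_left (hy a) hr) (mul_le_mul_of_nonneg_left (hz a) hs)

theorem mem_meanSet_of_mem_minimalSet {A : Finset X} {x : X}
    (hx : x ∈ minimalSet A) : x ∈ meanSet A := by
  classical
  let U : Set (A → ℝ) := Set.univ.pi fun a => Set.Iio (dist (a : X) x ^ 2)
  have hUc : Convex ℝ U := convex_pi fun _ _ => convex_Iio _
  have hUo : IsOpen U := isOpen_set_pi Set.finite_univ fun _ _ => isOpen_Iio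
  have hdisj : Disjoint U {v : A → ℝ | ∃ z : X, ∀ a : A, dist (a : X) z ^ 2 ≤ v a} := by
    refine Set.disjoint_left.2 ?_
    rintro v hv ⟨z, hz⟩
    exact hx ⟨z, fun a ha => lt_of_pow_lt_pow_left₀ 2 dist_nonneg
      ((hz ⟨a, ha⟩).trans_lt (hv ⟨a, ha⟩ (Set.mem_univ _)))⟩
  -- `D x` lies in the convex set and on the boundary of `U`, so `f (D x) = c`; moving down the
  -- diagonal gives `0 < f 1`, and moving up along a coordinate gives nonnegative coefficients.
  obtain ⟨f, c, hfU, hfC⟩ := geometric_hahn_banach_open hUc hUo (convex_setOf_dist_sq_le A) hdisj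
  have hf : ∀ v : A → ℝ, f v = ∑ a, f (Pi.single a 1) * v a := by
    intro v
    conv_lhs => rw [pi_eq_sum_univ' v]
    simp [mul_comm]
  set D : X → A → ℝ := fun z a => dist (a : X) z ^ 2 with hD
  have hfD : ∀ z, c ≤ f (D z) := fun z => hfC _ ⟨z, fun _ => le_rfl⟩
  have hlt : ∀ ε : ℝ, 0 < ε → f (D x) - ε * f 1 < c := by
    intro ε hε
    have := hfU (D x - ε • 1) fun a _ => by simp [hD, hε]
    simpa using this
  have hsum : 0 < f 1 := by
    have := hlt 1 one_pos
    linarith [hfD x]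
  have hxc : f (D x) ≤ c := by
    refine le_of_forall_pos_lt_add fun δ hδ => ?_
    have := hlt (δ / f 1) (div_pos hδ hsum)
    rw [div_mul_cancel₀ _ hsum.ne'] at this
    linarith
  have hnonneg : ∀ a, 0 ≤ f (Pi.single a 1) := by
    intro a
    have := hfC (D x + Pi.single a 1) ⟨x, fun b => by
      have : (0 : ℝ) ≤ (Pi.single a 1 : A → ℝ) b := by
        by_cases h : b = a
        · subst h; simp
        · simp [h]
      simpa [hD] using this⟩
    rw [map_add] at this
    linarith
  have hf1 : f 1 = ∑ a, f (Pi.single a 1) := by simpa using hf 1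
  refine ⟨fun a => f (Pi.single a 1) / f 1, ⟨fun a => div_nonneg (hnonneg a) hsum.le, ?_⟩,
    fun z => ?_⟩
  · rw [← Finset.sum_div, ← hf1, div_self hsum.ne']
  · have h : ∀ y : X, ∑ a : A, f (Pi.single a 1) / f 1 * dist (a : X) y ^ 2 = f (D y) / f 1 := by
      intro y
      rw [hf (D y), Finset.sum_div]
      exact Finset.sum_congr rfl fun a _ => by rw [hD]; ring
    rw [h, h]
    exact div_le_div_of_nonneg_right (hxc.trans (hfD z)) hsum.le

end HadamardSpace

/-- Some weight is positive, so a point closer to all of `A` would strictly lower the weighted sum;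
no curvature is involved. -/
theorem mem_minimalSet_of_mem_meanSet {X : Type*} [MetricSpace X] {A : Finset X} {x : X}
    (hx : x ∈ meanSet A) : x ∈ minimalSet A := by
  rintro ⟨z, hz⟩
  obtain ⟨w, ⟨hw₀, hw₁⟩, hw⟩ := hx
  have hsq : ∀ a : A, dist (a : X) z ^ 2 < dist (a : X) x ^ 2 := fun a =>
    pow_lt_pow_left₀ (hz a a.2) dist_nonneg two_ne_zero
  obtain ⟨a, -, ha⟩ : ∃ a ∈ Finset.univ, 0 < w a :=
    Finset.exists_lt_of_sum_lt (by rw [Finset.sum_const_zero, hw₁]; exact one_pos)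
  exact (hw z).not_gt (Finset.sum_lt_sum
    (fun b _ => mul_le_mul_of_nonneg_left (hsq b).le (hw₀ b))
    ⟨a, Finset.mem_univ a, mul_lt_mul_of_pos_left (hsq a) ha⟩)

theorem mainTheorem4 {X : Type*} [MetricSpace X] [HadamardSpace X]
    (A : Finset X) (hA : A.Nonempty) (x : X) :
    (x ∈ minimalSet A ↔ IsBalanced A x) ∧ (x ∈ minimalSet A ↔ x ∈ meanSet A) :=
  ⟨⟨HadamardSpace.isBalanced_of_mem_minimalSet, HadamardSpace.mem_minimalSet_of_isBalanced hA⟩,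
    ⟨HadamardSpace.mem_meanSet_of_mem_minimalSet, mem_minimalSet_of_mem_meanSet⟩⟩
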